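/- Let \(M\) be a compact (Hausdorff) smooth manifold without boundary, of dimension \(m\ge 0\), and let \(\mathbf A\) be a Weil algebra, i.e. a finite-dimensional commutative associative unital \(\mathbb R\)-algebra of the form \(\mathbf A=\mathbb R\oplus\mathcal A\), where \(\mathcal A\) is a maximal ideal with \(\mathcal A^{k+1}=0\) for some \(k\ge 1\). Let \(M^{\mathbf A}\) be the Weil bundle of \(M\), i.e. the set of all infinitely near points to points of \(M\) of kind \(\mathbf A\): the smooth morphisms of \(\mathbb R\)-algebras \(\xi:C^\infty(M)\to\mathbf A\) for which there is a point \(x=\pi_{\mathbf A}(\xi)\in M\) such that, for all \(f\in C^\infty(M)\), the component of \(\xi(f)\) in \(\mathbb R\) is \(f(x)\). Here \(\xi\) is called smooth if \(t\mapsto\xi(F(t,\cdot))\) is a smooth curve in \(\mathbf A\) for every smooth function \(F:\mathbb R\times M\to\mathbb R\). Equip \(M^{\mathbf A}\) with its manifold topology, given by the charts \(\pi_{\mathbf A}^{-1}(U)\to\mathbf A^m\), \(\xi\mapsto(\xi(\phi_1),\dots,\xi(\phi_m))\), where \((U,\phi_1,\dots,\phi_m)\) runs over the smooth charts of \(M\);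 here \(\xi(\phi_i)\) stands for \(\xi(f_i)\) with any \(f_i\in C^\infty(M)\) that agrees with \(\phi_i\) near \(\pi_{\mathbf A}(\xi)\). 1. If \(M\) is connected, then so is \(M^{\mathbf A}\). 2. If \(M\) is path-connected, then so is \(M^{\mathbf A}\). 3. If \(M\) is simply connected, then so is \(M^{\mathbf A}\). -/

import Mathlib

open scoped Manifold ContDiff Topology

/-- A Weil algebra: a finite-dimensional commutative associative unital real algebra `A` together
with a maximal ideal `𝒜` such that `A = ℝ·1 ⊕ 𝒜` and `𝒜 ^ (k + 1) = 0` for some `k ≥ 1`. -/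
class WeilAlgebra (A : Type*) [CommRing A] [Algebra ℝ A] where
  finiteDimensional : FiniteDimensional ℝ A
  /-- the ideal `𝒜` of infinitesimals -/
  infIdeal : Ideal A
  isMaximal : infIdeal.IsMaximal
  isCompl : IsCompl (Submodule.span ℝ {(1 : A)}) (infIdeal.restrictScalars ℝ)
  nilpotent : ∃ k : ℕ, 1 ≤ k ∧ infIdeal ^ (k + 1) = ⊥

/-- The points of the Weil bundle `M^A`: the infinitely near points of kind `A` to the points of
the `m`-dimensional smooth manifold `M`. Such a point, near to `base`, is a smooth morphism of real
algebras `hom : C^∞(M) → A` whose real part is evaluation at `base`. -/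
structure WeilBundle (m : ℕ) (M : Type*) [TopologicalSpace M]
    [ChartedSpace (EuclideanSpace ℝ (Fin m)) M]
    (A : Type*) [CommRing A] [Algebra ℝ A] [WeilAlgebra A] where
  /-- the base point, i.e. the image under the projection `M^A → M` -/
  base : M
  /-- the morphism of real algebras `C^∞(M) → A` -/
  hom : C^∞⟮𝓡 m, M; 𝓘(ℝ, ℝ), ℝ⟯ →ₐ[ℝ] A
  /-- In `A = ℝ ⊕ 𝒜`, the component of `hom f` in `ℝ` is `f base`. -/
  hom_sub_mem : ∀ f : C^∞⟮𝓡 m, M; 𝓘(ℝ, ℝ), ℝ⟯,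
    hom f - algebraMap ℝ A (f base) ∈ (WeilAlgebra.infIdeal : Ideal A)
  /-- `hom` is smooth: it maps smooth curves in `C^∞(M)`, that is, curves `t ↦ F t` for which
  `(t, y) ↦ F t y` is smooth on `ℝ × M`, to smooth curves in the finite-dimensional real vector
  space `A` (all of whose real coordinates are smooth). -/
  smooth : ∀ F : ℝ → C^∞⟮𝓡 m, M; 𝓘(ℝ, ℝ), ℝ⟯,
    ContMDiff (𝓘(ℝ, ℝ).prod (𝓡 m)) 𝓘(ℝ, ℝ) ∞ (fun p : ℝ × M => F p.1 p.2) →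
    ∀ l : A →ₗ[ℝ] ℝ, ContDiff ℝ ∞ (fun t : ℝ => l (hom (F t)))

namespace WeilBundle

variable {m : ℕ} {M : Type*} [TopologicalSpace M] [ChartedSpace (EuclideanSpace ℝ (Fin m)) M]
  {A : Type*} [CommRing A] [Algebra ℝ A] [WeilAlgebra A]

/-- `a = (ξ(φ₁), …, ξ(φ_m))` is the value at `ξ` of the chart `φ^A : π⁻¹(U) → A^m` induced by the
chart `(U, φ)` of `M`. The functions `φ_i` are defined on `U` only, and `ξ(φ_i)` means `ξ(f_i)` for
a globally defined smooth function `f_i` that agrees with `φ_i` near the base point of `ξ`. -/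
def IsChartValue (φ : OpenPartialHomeomorph M (EuclideanSpace ℝ (Fin m)))
    (ξ : WeilBundle m M A) (a : Fin m → A) : Prop :=
  ξ.base ∈ φ.source ∧ ∀ i : Fin m, ∃ f : C^∞⟮𝓡 m, M; 𝓘(ℝ, ℝ), ℝ⟯,
    (f : M → ℝ) =ᶠ[𝓝 ξ.base] (fun y => φ y i) ∧ ξ.hom f = a i

/-- The manifold topology of `M^A`: it is generated by the preimages of the open subsets `W` of
`A^m` under the charts `φ^A : π⁻¹(U) → A^m`, where `(U, φ)` runs over all smooth charts of `M`. -/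
instance [TopologicalSpace A] : TopologicalSpace (WeilBundle m M A) :=
  TopologicalSpace.generateFrom
    {O | ∃ φ ∈ IsManifold.maximalAtlas (𝓡 m) ∞ M, ∃ W : Set (Fin m → A), IsOpen W ∧
      O = {ξ | ∃ a ∈ W, IsChartValue φ ξ a}}

end WeilBundle

/-! In a chart, a point of `M^A` over `x` has coordinates `φ x + n` with `n` nilpotent, and
replacing `n` by `s • n` for `s` from 1 to 0 slides it to the zero section. To avoid building points
from prescribed coordinates, `contract` pushes `ξ` forward along the homothety of ratio `s` centred
at its base point; this needs only a germ, because `ξ` is determined by germs (`hom_congr`).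

The homothety depends on the chart, so `localContraction` uses ratio `1 - t * ρ x` with a bump
function `ρ`. By compactness finitely many such homotopies, composed, contract everything: each
preserves base points and fixes the zero section, so nothing already contracted is disturbed. Hence
the projection is a homotopy equivalence with the zero section as inverse.

The work lies in continuity. By `isInducing_hom` the chart topology is pointwise convergence of `ξ ↦
ξ.hom f`. Its core, `continuousOn_mul_eval`, iterates Hadamard's lemma at the base point, a Taylor
expansion that stops because `𝒜` is nilpotent. -/

/-! ### Parametric integrals and Hadamard's lemma. -/

section ParametricIntegral

open MeasureTheory

universe u

/-- Differentiation under the integral sign over the unit interval. -/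
theorem hasFDerivAt_intervalIntegral_of_contDiff {E G : Type u} [NormedAddCommGroup E]
    [NormedSpace ℝ E] [ProperSpace E] [NormedAddCommGroup G] [NormedSpace ℝ G] [CompleteSpace G]
    {F : E × ℝ → G} (hF : ContDiff ℝ 1 F) (x : E) :
    HasFDerivAt (fun x => ∫ s in (0 : ℝ)..1, F (x, s))
      (∫ s in (0 : ℝ)..1, (fderiv ℝ F (x, s)).comp (ContinuousLinearMap.inl ℝ E ℝ)) x := by
  have hd : Continuous fun p : E × ℝ =>
      (fderiv ℝ F p).comp (ContinuousLinearMap.inl ℝ E ℝ) :=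
    (hF.continuous_fderiv one_ne_zero).clm_comp continuous_const
  -- `E` is proper, so the derivative is bounded on the compact product of the unit ball and `[0,
  -- 1]`; this constant dominates.
  obtain ⟨C, hC⟩ := ((isCompact_closedBall x 1).prod (isCompact_Icc (a := (0 : ℝ)) (b := 1))
    ).exists_bound_of_continuousOn hd.continuousOn
  refine (intervalIntegral.hasFDerivAt_integral_of_dominated_of_fderiv_le
    (F' := fun y s => (fderiv ℝ F (y, s)).comp (ContinuousLinearMap.inl ℝ E ℝ))
    (bound := fun _ => C) (Metric.ball_mem_nhds x one_pos) ?_ ?_ ?_ ?_ ?_ ?_)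
  · exact .of_forall fun y =>
      (hF.continuous.comp (Continuous.prodMk_right y)).aestronglyMeasurable
  · exact (hF.continuous.comp (Continuous.prodMk_right x)).intervalIntegrable _ _
  · exact (hd.comp (Continuous.prodMk_right x)).aestronglyMeasurable
  · refine .of_forall fun s hs y hy => hC (y, s) ⟨Metric.ball_subset_closedBall hy, ?_⟩
    rw [Set.uIoc_of_le zero_le_one] at hs
    exact ⟨hs.1.le, hs.2⟩
  · exact intervalIntegrable_const
  · refine .of_forall fun s _ y _ => ?_
    have h1 := (hF.differentiable one_ne_zero (y, s)).hasFDerivAt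
    exact h1.comp y (hasFDerivAt_prodMk_left y s)

/-- Induction on `n` with `G` varying: the derivative is an integral of the same kind with values in
`E →L[ℝ] G`. A common universe keeps that space within the range of the induction. -/
theorem contDiff_intervalIntegral_of_contDiff_nat {E : Type u} [NormedAddCommGroup E]
    [NormedSpace ℝ E] [ProperSpace E] (n : ℕ) : ∀ {G : Type u} [NormedAddCommGroup G]
    [NormedSpace ℝ G] [CompleteSpace G] {F : E × ℝ → G}, ContDiff ℝ n F →
    ContDiff ℝ n (fun x => ∫ s in (0 : ℝ)..1, F (x, s)) := by
  induction n with
  | zero =>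
    intro G _ _ _ F hF
    rw [Nat.cast_zero, contDiff_zero] at *
    exact intervalIntegral.continuous_parametric_intervalIntegral_of_continuous'
      (f := fun x s => F (x, s)) hF 0 1
  | succ n ih =>
    intro G _ _ _ F hF
    have h1 : ContDiff ℝ 1 F := hF.of_le (by exact_mod_cast Nat.le_add_left 1 n)
    refine contDiff_succ_iff_hasFDerivAt.2 ⟨_, ?_, hasFDerivAt_intervalIntegral_of_contDiff h1⟩
    refine ih (F := fun p => (fderiv ℝ F p).comp (ContinuousLinearMap.inl ℝ E ℝ)) ?_
    exact (hF.fderiv_right (by norm_cast)).clm_comp contDiff_const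

/-- Integrating a smooth function of `(x, s)` over `s ∈ [0, 1]` gives a smooth function of `x`. -/
theorem contDiff_intervalIntegral_of_contDiff {E G : Type u} [NormedAddCommGroup E]
    [NormedSpace ℝ E] [ProperSpace E] [NormedAddCommGroup G] [NormedSpace ℝ G] [CompleteSpace G]
    {F : E × ℝ → G} (hF : ContDiff ℝ ∞ F) :
    ContDiff ℝ ∞ (fun x => ∫ s in (0 : ℝ)..1, F (x, s)) :=
  contDiff_infty.2 fun n => contDiff_intervalIntegral_of_contDiff_nat n (contDiff_infty.1 hF n)

/-- Hadamard's lemma with parameters. -/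
theorem exists_contDiff_eq_add_sum_sub_mul {m : ℕ}
    {G : EuclideanSpace ℝ (Fin m) × EuclideanSpace ℝ (Fin m) → ℝ} (hG : ContDiff ℝ ∞ G) :
    ∃ D : Fin m → EuclideanSpace ℝ (Fin m) × EuclideanSpace ℝ (Fin m) → ℝ,
      (∀ i, ContDiff ℝ ∞ (D i)) ∧
      ∀ x y, G (x, y) = G (x, x) + ∑ i, (y i - x i) * D i (x, y) := by
  -- `D i` averages the `i`-th partial derivative of `G` in its second argument over the segment
  -- from `x` to `y`.
  refine ⟨fun i p => ∫ s in (0 : ℝ)..1,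
    fderiv ℝ G (p.1, p.1 + s • (p.2 - p.1)) (0, EuclideanSpace.single i 1), fun i => ?_,
    fun x y => ?_⟩
  · refine contDiff_intervalIntegral_of_contDiff (F := fun q : (EuclideanSpace ℝ (Fin m) ×
      EuclideanSpace ℝ (Fin m)) × ℝ => fderiv ℝ G (q.1.1, q.1.1 + q.2 • (q.1.2 - q.1.1))
        (0, EuclideanSpace.single i 1)) ?_
    refine ContDiff.clm_apply ?_ contDiff_const
    refine (hG.fderiv_right (m := ∞) (by simp)).comp ?_
    fun_prop
  · have hd : Differentiable ℝ G := hG.differentiable (by simp)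
    have hc : Continuous (fderiv ℝ G) := hG.continuous_fderiv (by simp)
    have hpath : ∀ s : ℝ, HasDerivAt (fun s : ℝ => (x, x + s • (y - x)))
        ((0 : EuclideanSpace ℝ (Fin m)), y - x) s := fun s => by
      refine (hasDerivAt_const s x).prodMk ?_
      simpa using ((hasDerivAt_id s).smul_const (y - x)).const_add x
    have key := intervalIntegral.integral_eq_sub_of_hasDerivAt (a := 0) (b := 1)
      (f := fun s : ℝ => G (x, x + s • (y - x)))
      (f' := fun s => fderiv ℝ G (x, x + s • (y - x)) (0, y - x))
      (fun s _ => (hd _).hasFDerivAt.comp_hasDerivAt s (hpath s))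
      (Continuous.intervalIntegrable (by fun_prop) _ _)
    have hsum : ((0 : EuclideanSpace ℝ (Fin m)), y - x)
        = ∑ i, (y i - x i) • ((0 : EuclideanSpace ℝ (Fin m)), EuclideanSpace.single i (1 : ℝ)) := by
      refine Prod.ext (by simp [Prod.fst_sum]) ?_
      ext j
      simp [Prod.snd_sum, Finset.sum_apply, Pi.single_apply]
    have : ∫ s in (0 : ℝ)..1, fderiv ℝ G (x, x + s • (y - x)) (0, y - x)
        = ∑ i, (y i - x i) * ∫ s in (0 : ℝ)..1,
          fderiv ℝ G (x, x + s • (y - x)) (0, EuclideanSpace.single i 1) := by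
      simp_rw [hsum, map_sum, map_smul, smul_eq_mul]
      rw [intervalIntegral.integral_finsetSum]
      · simp_rw [intervalIntegral.integral_const_mul]
      · intro i _
        exact Continuous.intervalIntegrable (by fun_prop) _ _
    rw [this] at key
    simp only [one_smul, add_sub_cancel, zero_smul, add_zero] at key
    linarith

end ParametricIntegral

/-! ### The real part on a Weil algebra, and its topology. -/

namespace WeilAlgebra

variable (A : Type*) [CommRing A] [Algebra ℝ A] [WeilAlgebra A]

theorem one_notMem_infIdeal : (1 : A) ∉ (infIdeal : Ideal A) := fun h =>
  (isMaximal : (infIdeal : Ideal A).IsMaximal).ne_top ((Ideal.eq_top_iff_one _).2 h)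

variable {A}

/-- A proper ideal contains no unit. This gives uniqueness of the real part, hence linearity of
`re`. -/
theorem algebraMap_mem_infIdeal {r : ℝ} (h : algebraMap ℝ A r ∈ (infIdeal : Ideal A)) : r = 0 := by
  by_contra hr
  refine one_notMem_infIdeal A ?_
  have := Ideal.mul_mem_left _ (algebraMap ℝ A r⁻¹) h
  rwa [← map_mul, inv_mul_cancel₀ hr, map_one] at this

theorem exists_sub_algebraMap_mem (a : A) :
    ∃ r : ℝ, a - algebraMap ℝ A r ∈ (infIdeal : Ideal A) := by
  have h : a ∈ Submodule.span ℝ {(1 : A)} ⊔ (infIdeal : Ideal A).restrictScalars ℝ := by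
    rw [(isCompl : IsCompl (Submodule.span ℝ {(1 : A)}) _).sup_eq_top]; trivial
  obtain ⟨b, hb, c, hc, rfl⟩ := Submodule.mem_sup.1 h
  obtain ⟨r, rfl⟩ := Submodule.mem_span_singleton.1 hb
  refine ⟨r, ?_⟩
  rw [Algebra.algebraMap_eq_smul_one, add_sub_cancel_left]
  exact hc

/-- The component of an element of `A = ℝ ⊕ 𝒜` in `ℝ`. -/
noncomputable def re : A →ₗ[ℝ] ℝ where
  toFun a := (exists_sub_algebraMap_mem a).choose
  map_add' a b := by
    rw [← sub_eq_zero]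
    refine algebraMap_mem_infIdeal (A := A) ?_
    have h1 := (exists_sub_algebraMap_mem a).choose_spec
    have h2 := (exists_sub_algebraMap_mem b).choose_spec
    have h3 := (exists_sub_algebraMap_mem (a + b)).choose_spec
    have := Ideal.sub_mem _ (Ideal.add_mem _ h1 h2) h3
    rw [map_sub, map_add]
    convert this using 1
    ring
  map_smul' c a := by
    rw [← sub_eq_zero]
    refine algebraMap_mem_infIdeal (A := A) ?_
    have h1 := (exists_sub_algebraMap_mem a).choose_spec
    have h3 := (exists_sub_algebraMap_mem (c • a)).choose_spec
    have := Ideal.sub_mem _ (Ideal.mul_mem_left _ (algebraMap ℝ A c) h1) h3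
    rw [map_sub, RingHom.id_apply, smul_eq_mul, map_mul]
    convert this using 1
    rw [Algebra.smul_def]
    ring

theorem sub_algebraMap_re_mem (a : A) : a - algebraMap ℝ A (re a) ∈ (infIdeal : Ideal A) :=
  (exists_sub_algebraMap_mem a).choose_spec

theorem re_eq_of_sub_mem {a : A} {r : ℝ} (h : a - algebraMap ℝ A r ∈ (infIdeal : Ideal A)) :
    re a = r := by
  rw [← sub_eq_zero]
  refine algebraMap_mem_infIdeal (A := A) ?_
  have := Ideal.sub_mem _ h (sub_algebraMap_re_mem a)
  rw [map_sub]
  convert this using 1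
  ring

/-- A nonzero real plus a nilpotent is invertible. -/
theorem isUnit_of_re_ne_zero {a : A} (h : re a ≠ 0) : IsUnit a := by
  obtain ⟨k, -, hk⟩ := (nilpotent : ∃ k : ℕ, 1 ≤ k ∧ (infIdeal : Ideal A) ^ (k + 1) = ⊥)
  have hn : IsNilpotent (a - algebraMap ℝ A (re a)) :=
    ⟨k + 1, by simpa [hk] using Ideal.pow_mem_pow (sub_algebraMap_re_mem a) (k + 1)⟩
  have := hn.isUnit_add_left_of_commute ((Ne.isUnit h).map (algebraMap ℝ A)) (Commute.all _ _)
  simpa using this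

instance : FiniteDimensional ℝ A := finiteDimensional

variable [TopologicalSpace A] [IsTopologicalAddGroup A] [ContinuousSMul ℝ A] [T2Space A]

theorem continuous_re : Continuous (re : A →ₗ[ℝ] ℝ) := LinearMap.continuous_of_finiteDimensional _

variable (A) in
theorem continuousMul : ContinuousMul A :=
  haveI : IsModuleTopology ℝ A := isModuleTopologyOfFiniteDimensional
  ⟨IsModuleTopology.continuous_mul_of_finite ℝ A⟩

end WeilAlgebra

/-! ### Bump functions and germs of global smooth functions. -/

section Bump

variable {m : ℕ} {M : Type*} [TopologicalSpace M] [ChartedSpace (EuclideanSpace ℝ (Fin m)) M]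

/-- The function `h` agrees near `x` with a globally defined smooth function. -/
def SmoothGerm (m : ℕ) {M : Type*} [TopologicalSpace M]
    [ChartedSpace (EuclideanSpace ℝ (Fin m)) M] (x : M) (h : M → ℝ) : Prop :=
  ∃ f : C^∞⟮𝓡 m, M; 𝓘(ℝ, ℝ), ℝ⟯, (f : M → ℝ) =ᶠ[𝓝 x] h

namespace SmoothGerm

theorem coe (x : M) (f : C^∞⟮𝓡 m, M; 𝓘(ℝ, ℝ), ℝ⟯) : SmoothGerm m x f := ⟨f, .rfl⟩

theorem congr {x : M} {h h' : M → ℝ} (hh : SmoothGerm m x h) (e : h =ᶠ[𝓝 x] h') :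
    SmoothGerm m x h' := ⟨hh.choose, hh.choose_spec.trans e⟩

theorem const (x : M) (r : ℝ) : SmoothGerm m x fun _ => r :=
  ⟨algebraMap ℝ C^∞⟮𝓡 m, M; 𝓘(ℝ, ℝ), ℝ⟯ r, .rfl⟩

theorem add {x : M} {h h' : M → ℝ} : SmoothGerm m x h → SmoothGerm m x h' →
    SmoothGerm m x (fun y => h y + h' y) := fun ⟨f, hf⟩ ⟨f', hf'⟩ => ⟨f + f', hf.add hf'⟩

theorem mul {x : M} {h h' : M → ℝ} : SmoothGerm m x h → SmoothGerm m x h' →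
    SmoothGerm m x (fun y => h y * h' y) := fun ⟨f, hf⟩ ⟨f', hf'⟩ => ⟨f * f', hf.mul hf'⟩

theorem sum {ι : Type*} (s : Finset ι) {x : M} {h : ι → M → ℝ}
    (hh : ∀ i ∈ s, SmoothGerm m x (h i)) : SmoothGerm m x (fun y => ∑ i ∈ s, h i y) := by
  classical
  induction s using Finset.induction_on with
  | empty => simpa using const x 0
  | insert i s hi ih =>
    simp_rw [Finset.sum_insert hi]
    exact (hh i (s.mem_insert_self i)).add (ih fun j hj => hh j (Finset.mem_insert_of_mem hj))

end SmoothGerm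

variable [T2Space M] [IsManifold (𝓡 m) ∞ M]

theorem exists_contMDiffMap_eventuallyEq_one_tsupport_subset {x : M} {U : Set M} (hU : U ∈ 𝓝 x) :
    ∃ χ : C^∞⟮𝓡 m, M; 𝓘(ℝ, ℝ), ℝ⟯, (χ : M → ℝ) =ᶠ[𝓝 x] 1 ∧ tsupport χ ⊆ U := by
  obtain ⟨f, -, hf⟩ := (SmoothBumpFunction.nhds_basis_tsupport (I := 𝓡 m) x).mem_iff.1 hU
  exact ⟨⟨f, f.contMDiff⟩, f.eventuallyEq_one, hf⟩

theorem SmoothGerm.of_contMDiffOn {x : M} {h : M → ℝ} {U : Set M} (hU : IsOpen U) (hx : x ∈ U)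
    (hh : ContMDiffOn (𝓡 m) 𝓘(ℝ, ℝ) ∞ h U) : SmoothGerm m x h := by
  obtain ⟨χ, hχ1, hχU⟩ := exists_contMDiffMap_eventuallyEq_one_tsupport_subset (m := m)
     (hU.mem_nhds hx)
  refine ⟨⟨fun y => χ y • h y, contMDiff_of_tsupport fun y hy => ?_⟩, ?_⟩
  · have hyU := hχU (tsupport_smul_subset_left _ _ hy)
    exact (χ.contMDiff y).smul ((hh y hyU).contMDiffAt (hU.mem_nhds hyU))
  · filter_upwards [hχ1] with y hy
    change χ y • h y = h y
    rw [hy, Pi.one_apply, one_smul]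

/-- A smooth family of functions on an open set `U` agrees near each of its points `x` with a smooth
family of globally defined functions, on a neighbourhood of `x` independent of the parameter. -/
theorem exists_family_contMDiffMap_eventuallyEq {x : M} {F : ℝ → M → ℝ} {U : Set M}
    (hU : IsOpen U) (hx : x ∈ U)
    (hF : ContMDiffOn (𝓘(ℝ, ℝ).prod (𝓡 m)) 𝓘(ℝ, ℝ) ∞ (fun p : ℝ × M => F p.1 p.2)
      (Set.univ ×ˢ U)) :
    ∃ F' : ℝ → C^∞⟮𝓡 m, M; 𝓘(ℝ, ℝ), ℝ⟯,
      ContMDiff (𝓘(ℝ, ℝ).prod (𝓡 m)) 𝓘(ℝ, ℝ) ∞ (fun p : ℝ × M => F' p.1 p.2) ∧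
      ∀ t, (F' t : M → ℝ) =ᶠ[𝓝 x] F t := by
  obtain ⟨χ, hχ1, hχU⟩ := exists_contMDiffMap_eventuallyEq_one_tsupport_subset (m := m)
     (hU.mem_nhds hx)
  have hs : ContMDiff (𝓘(ℝ, ℝ).prod (𝓡 m)) 𝓘(ℝ, ℝ) ∞
      (fun p : ℝ × M => χ p.2 • F p.1 p.2) := by
    refine contMDiff_of_tsupport fun p hp => ?_
    have h1 : p ∈ tsupport (fun p : ℝ × M => χ p.2) := tsupport_smul_subset_left _ _ hp
    have h2 : p.2 ∈ tsupport χ :=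
      tsupport_comp_subset_preimage (f := Prod.snd (α := ℝ)) χ continuous_snd h1
    have hpU : p ∈ (Set.univ : Set ℝ) ×ˢ U := ⟨trivial, hχU h2⟩
    exact ((χ.contMDiff.comp contMDiff_snd) p).smul
      ((hF p hpU).contMDiffAt ((isOpen_univ.prod hU).mem_nhds hpU))
  refine ⟨fun t => ⟨fun y => χ y • F t y,
    hs.comp (contMDiff_const.prodMk contMDiff_id)⟩, hs, fun t => ?_⟩
  filter_upwards [hχ1] with y hy
  change χ y • F t y = F t y
  rw [hy, Pi.one_apply, one_smul]

end Bump

/-! ### Evaluation on germs and push-forward of infinitely near points. -/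

namespace WeilBundle

open WeilAlgebra

variable {m : ℕ} {M : Type*} [TopologicalSpace M] [ChartedSpace (EuclideanSpace ℝ (Fin m)) M]
  {A : Type*} [CommRing A] [Algebra ℝ A] [WeilAlgebra A]

@[ext]
theorem ext {ξ η : WeilBundle m M A} (hb : ξ.base = η.base) (hh : ∀ f, ξ.hom f = η.hom f) :
    ξ = η := by
  cases ξ; cases η
  obtain rfl := hb
  congr
  exact AlgHom.ext hh

theorem re_hom (ξ : WeilBundle m M A) (f : C^∞⟮𝓡 m, M; 𝓘(ℝ, ℝ), ℝ⟯) :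
    re (ξ.hom f) = f ξ.base := re_eq_of_sub_mem (ξ.hom_sub_mem f)

open Classical in
/-- The value of an infinitely near point on the germ at the base point of a smooth function. -/
noncomputable def eval (ξ : WeilBundle m M A) (h : M → ℝ) : A :=
  -- The chosen extension is immaterial by `hom_congr`. The value 0 is junk, which is why later
  -- rules assume `SmoothGerm`.
  if hh : SmoothGerm m ξ.base h then ξ.hom hh.choose else 0

/-- The point `x` of `M`, viewed as an infinitely near point to itself. -/
noncomputable def zeroSection (A : Type*) [CommRing A] [Algebra ℝ A] [WeilAlgebra A] (x : M) :
    WeilBundle m M A where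
  base := x
  hom := (Algebra.ofId ℝ A).comp
    { toFun := fun f => f x
      map_one' := rfl
      map_mul' := fun _ _ => rfl
      map_zero' := rfl
      map_add' := fun _ _ => rfl
      commutes' := fun _ => rfl }
  hom_sub_mem f := by
    change algebraMap ℝ A (f x) - algebraMap ℝ A (f x) ∈ _
    rw [sub_self]
    exact zero_mem _
  smooth F hF l := by
    have h1 : ContMDiff 𝓘(ℝ, ℝ) 𝓘(ℝ, ℝ) ∞ fun t => F t x :=
      hF.comp (contMDiff_id.prodMk contMDiff_const)
    have h2 : (fun t => l (algebraMap ℝ A (F t x))) = fun t => F t x * l 1 := by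
      funext t
      rw [Algebra.algebraMap_eq_smul_one, map_smul, smul_eq_mul]
    exact h2 ▸ h1.contDiff.mul contDiff_const

@[simp]
theorem zeroSection_hom (x : M) (f : C^∞⟮𝓡 m, M; 𝓘(ℝ, ℝ), ℝ⟯) :
    (zeroSection A x).hom f = algebraMap ℝ A (f x) := rfl

variable [T2Space M] [IsManifold (𝓡 m) ∞ M]

/-- An infinitely near point depends only on germs at its base point. -/
theorem hom_congr (ξ : WeilBundle m M A) {f g : C^∞⟮𝓡 m, M; 𝓘(ℝ, ℝ), ℝ⟯}
    (h : (f : M → ℝ) =ᶠ[𝓝 ξ.base] g) : ξ.hom f = ξ.hom g := by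
  obtain ⟨χ, hχ1, hχU⟩ := exists_contMDiffMap_eventuallyEq_one_tsupport_subset (m := m)
     h
  have hz : χ * (f - g) = 0 := by
    ext y
    by_cases hy : y ∈ tsupport χ
    · have : f y = g y := hχU hy
      change χ y * (f y - g y) = 0
      rw [this, sub_self, mul_zero]
    · change χ y * (f y - g y) = 0
      rw [image_eq_zero_of_notMem_tsupport hy, zero_mul]
  -- The real part of `ξ.hom χ` is 1, so this factor can be cancelled from `χ * (f - g) = 0`.
  have hu : IsUnit (ξ.hom χ) := isUnit_of_re_ne_zero (by
    rw [re_hom, hχ1.eq_of_nhds]; exact one_ne_zero)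
  have h0 : ξ.hom χ * (ξ.hom f - ξ.hom g) = 0 := by rw [← map_sub, ← map_mul, hz, map_zero]
  exact sub_eq_zero.1 ((hu.mul_right_eq_zero).1 h0)

theorem eval_eq_hom (ξ : WeilBundle m M A) {h : M → ℝ} {f : C^∞⟮𝓡 m, M; 𝓘(ℝ, ℝ), ℝ⟯}
    (hf : (f : M → ℝ) =ᶠ[𝓝 ξ.base] h) : ξ.eval h = ξ.hom f := by
  have hh : SmoothGerm m ξ.base h := ⟨f, hf⟩
  rw [eval, dif_pos hh]
  exact ξ.hom_congr (hh.choose_spec.trans hf.symm)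

@[simp]
theorem eval_coe (ξ : WeilBundle m M A) (f : C^∞⟮𝓡 m, M; 𝓘(ℝ, ℝ), ℝ⟯) :
    ξ.eval f = ξ.hom f := ξ.eval_eq_hom .rfl

theorem eval_congr (ξ : WeilBundle m M A) {h h' : M → ℝ} (hh : SmoothGerm m ξ.base h)
    (e : h =ᶠ[𝓝 ξ.base] h') : ξ.eval h = ξ.eval h' := by
  obtain ⟨f, hf⟩ := hh
  rw [ξ.eval_eq_hom hf, ξ.eval_eq_hom (hf.trans e)]

theorem eval_const (ξ : WeilBundle m M A) (r : ℝ) : ξ.eval (fun _ => r) = algebraMap ℝ A r := by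
  exact (ξ.eval_eq_hom (f := algebraMap ℝ C^∞⟮𝓡 m, M; 𝓘(ℝ, ℝ), ℝ⟯ r) .rfl).trans
    (ξ.hom.commutes r)

theorem eval_add (ξ : WeilBundle m M A) {h h' : M → ℝ} (hh : SmoothGerm m ξ.base h)
    (hh' : SmoothGerm m ξ.base h') : ξ.eval (fun y => h y + h' y) = ξ.eval h + ξ.eval h' := by
  obtain ⟨f, hf⟩ := hh
  obtain ⟨f', hf'⟩ := hh'
  refine (ξ.eval_eq_hom (f := f + f') (hf.add hf')).trans ?_
  rw [ξ.eval_eq_hom hf, ξ.eval_eq_hom hf', map_add]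

theorem eval_mul (ξ : WeilBundle m M A) {h h' : M → ℝ} (hh : SmoothGerm m ξ.base h)
    (hh' : SmoothGerm m ξ.base h') : ξ.eval (fun y => h y * h' y) = ξ.eval h * ξ.eval h' := by
  obtain ⟨f, hf⟩ := hh
  obtain ⟨f', hf'⟩ := hh'
  refine (ξ.eval_eq_hom (f := f * f') (hf.mul hf')).trans ?_
  rw [ξ.eval_eq_hom hf, ξ.eval_eq_hom hf', map_mul]

theorem eval_sum (ξ : WeilBundle m M A) {ι : Type*} (s : Finset ι) {h : ι → M → ℝ}
    (hh : ∀ i ∈ s, SmoothGerm m ξ.base (h i)) :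
    ξ.eval (fun y => ∑ i ∈ s, h i y) = ∑ i ∈ s, ξ.eval (h i) := by
  classical
  induction s using Finset.induction_on with
  | empty => simpa using ξ.eval_const 0
  | insert i s hi ih =>
    have hs := fun j hj => hh j (Finset.mem_insert_of_mem hj)
    simp_rw [Finset.sum_insert hi]
    rw [ξ.eval_add (hh i (s.mem_insert_self i)) (SmoothGerm.sum s hs), ih hs]

theorem re_eval (ξ : WeilBundle m M A) {h : M → ℝ} (hh : SmoothGerm m ξ.base h) :
    re (ξ.eval h) = h ξ.base := by
  obtain ⟨f, hf⟩ := hh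
  rw [ξ.eval_eq_hom hf, re_hom, hf.eq_of_nhds]

/-- The image of an infinitely near point under a map which is smooth near its base point. -/
noncomputable def map (ξ : WeilBundle m M A) (μ : M → M) (U : Set M) (hU : IsOpen U)
    (hx : ξ.base ∈ U) (hμ : ContMDiffOn (𝓡 m) (𝓡 m) ∞ μ U) : WeilBundle m M A where
  base := μ ξ.base
  hom :=
    have hg (f : C^∞⟮𝓡 m, M; 𝓘(ℝ, ℝ), ℝ⟯) : SmoothGerm m ξ.base (fun y => f (μ y)) :=
      .of_contMDiffOn hU hx (f.contMDiff.comp_contMDiffOn hμ)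
    { toFun := fun f => ξ.eval (fun y => f (μ y))
      map_one' := (ξ.eval_const 1).trans (map_one _)
      map_mul' := fun f g => ξ.eval_mul (hg f) (hg g)
      map_zero' := (ξ.eval_const 0).trans (map_zero _)
      map_add' := fun f g => ξ.eval_add (hg f) (hg g)
      commutes' := fun r => ξ.eval_const r }
  hom_sub_mem f := by
    have hg : SmoothGerm m ξ.base (fun y => f (μ y)) :=
      .of_contMDiffOn hU hx (f.contMDiff.comp_contMDiffOn hμ)
    have := sub_algebraMap_re_mem (ξ.eval (fun y => f (μ y)))
    rwa [ξ.re_eval hg] at this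
  smooth F hF l := by
    -- The family `F t ∘ μ` is known to be smooth only on `U`; one cutoff for all `t` globalises it,
    -- so smoothness of `ξ` applies.
    obtain ⟨F', hF', he⟩ := exists_family_contMDiffMap_eventuallyEq (F := fun t y => F t (μ y))
      hU hx (hF.comp_contMDiffOn (contMDiffOn_fst.prodMk
        (hμ.comp contMDiffOn_snd fun p hp => hp.2)))
    have h2 : (fun t => l (ξ.eval (fun y => F t (μ y)))) = fun t => l (ξ.hom (F' t)) := by
      funext t
      rw [ξ.eval_eq_hom (he t)]
    exact h2 ▸ ξ.smooth F' hF' l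

theorem map_hom (ξ : WeilBundle m M A) (μ : M → M) (U : Set M) (hU : IsOpen U)
    (hx : ξ.base ∈ U) (hμ : ContMDiffOn (𝓡 m) (𝓡 m) ∞ μ U) (f : C^∞⟮𝓡 m, M; 𝓘(ℝ, ℝ), ℝ⟯) :
    (ξ.map μ U hU hx hμ).hom f = ξ.eval (fun y => f (μ y)) := rfl

theorem map_eval (ξ : WeilBundle m M A) (μ : M → M) (U : Set M) (hU : IsOpen U)
    (hx : ξ.base ∈ U) (hμ : ContMDiffOn (𝓡 m) (𝓡 m) ∞ μ U) {h : M → ℝ}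
    (hh : SmoothGerm m (μ ξ.base) h) :
    (ξ.map μ U hU hx hμ).eval h = ξ.eval (fun y => h (μ y)) := by
  obtain ⟨f, hf⟩ := hh
  rw [eval_eq_hom (f := f) _ hf, map_hom]
  exact ξ.eval_congr (.of_contMDiffOn hU hx (f.contMDiff.comp_contMDiffOn hμ))
    ((hμ.continuousOn.continuousAt (hU.mem_nhds hx)).eventually hf)

end WeilBundle

/-! ### Chart coordinates and the topology of the Weil bundle. -/

namespace WeilBundle

open WeilAlgebra

variable {m : ℕ} {M : Type*} [TopologicalSpace M] [ChartedSpace (EuclideanSpace ℝ (Fin m)) M]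
  {A : Type*} [CommRing A] [Algebra ℝ A] [WeilAlgebra A]

/-- The coordinates of an infinitely near point in the chart induced by a chart of `M`. -/
noncomputable def coord (φ : OpenPartialHomeomorph M (EuclideanSpace ℝ (Fin m)))
    (ξ : WeilBundle m M A) (i : Fin m) : A := ξ.eval (fun y => φ y i)

variable [T2Space M] [IsManifold (𝓡 m) ∞ M]
  {φ : OpenPartialHomeomorph M (EuclideanSpace ℝ (Fin m))}

theorem smoothGerm_comp_chart (hφ : φ ∈ IsManifold.maximalAtlas (𝓡 m) ∞ M) {x : M}
    (hx : x ∈ φ.source) {g : EuclideanSpace ℝ (Fin m) → ℝ} (hg : ContDiff ℝ ∞ g) :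
    SmoothGerm m x (fun y => g (φ y)) :=
  .of_contMDiffOn φ.open_source hx
    (hg.contMDiff.comp_contMDiffOn (contMDiffOn_of_mem_maximalAtlas hφ))

theorem smoothGerm_chart (hφ : φ ∈ IsManifold.maximalAtlas (𝓡 m) ∞ M) {x : M}
    (hx : x ∈ φ.source) (i : Fin m) : SmoothGerm m x (fun y => φ y i) :=
  smoothGerm_comp_chart hφ hx (g := fun v => v i) (by fun_prop)

theorem re_coord (hφ : φ ∈ IsManifold.maximalAtlas (𝓡 m) ∞ M) {ξ : WeilBundle m M A}
    (hξ : ξ.base ∈ φ.source) (i : Fin m) : re (coord φ ξ i) = φ ξ.base i :=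
  ξ.re_eval (smoothGerm_chart hφ hξ i)

theorem isChartValue_iff (hφ : φ ∈ IsManifold.maximalAtlas (𝓡 m) ∞ M) {ξ : WeilBundle m M A}
    {a : Fin m → A} : IsChartValue φ ξ a ↔ ξ.base ∈ φ.source ∧ a = coord φ ξ := by
  refine and_congr_right fun hξ => ⟨fun h => ?_, ?_⟩
  · funext i
    obtain ⟨f, hf, hfa⟩ := h i
    rw [← hfa, coord, ξ.eval_eq_hom hf]
  · rintro rfl i
    obtain ⟨f, hf⟩ := smoothGerm_chart hφ hξ i
    exact ⟨f, hf, (ξ.eval_eq_hom hf).symm⟩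

theorem eval_comp_chart {ξ : WeilBundle m M A} {f : C^∞⟮𝓡 m, M; 𝓘(ℝ, ℝ), ℝ⟯}
    {g : EuclideanSpace ℝ (Fin m) → ℝ} (h : ∀ᶠ y in 𝓝 ξ.base, f y = g (φ y)) :
    ξ.eval (fun y => g (φ y)) = ξ.hom f := ξ.eval_eq_hom h

variable [TopologicalSpace A]

theorem isOpen_setOf_coord_mem (hφ : φ ∈ IsManifold.maximalAtlas (𝓡 m) ∞ M) {W : Set (Fin m → A)}
    (hW : IsOpen W) : IsOpen {ξ : WeilBundle m M A | ξ.base ∈ φ.source ∧ coord φ ξ ∈ W} := by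
  refine TopologicalSpace.isOpen_generateFrom_of_mem ⟨φ, hφ, W, hW, ?_⟩
  ext ξ
  simp only [isChartValue_iff hφ, Set.mem_ofPred_eq]
  constructor
  · rintro ⟨h1, h2⟩
    exact ⟨_, h2, h1, rfl⟩
  · rintro ⟨_, h2, h1, rfl⟩
    exact ⟨h1, h2⟩

theorem isOpen_setOf_base_mem_source (hφ : φ ∈ IsManifold.maximalAtlas (𝓡 m) ∞ M) :
    IsOpen {ξ : WeilBundle m M A | ξ.base ∈ φ.source} := by
  simpa using isOpen_setOf_coord_mem (A := A) hφ isOpen_univ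

theorem continuousOn_coord (hφ : φ ∈ IsManifold.maximalAtlas (𝓡 m) ∞ M) :
    ContinuousOn (coord φ) {ξ : WeilBundle m M A | ξ.base ∈ φ.source} := by
  rw [continuousOn_open_iff (isOpen_setOf_base_mem_source hφ)]
  exact fun W hW => isOpen_setOf_coord_mem hφ hW

variable [IsTopologicalAddGroup A] [ContinuousSMul ℝ A] [T2Space A]
  {X : Type*} [TopologicalSpace X] {S : Set X} {h : X → WeilBundle m M A}

/-- The coordinates of the base point are the real parts of the coordinates in `A`. -/
theorem continuousOn_chart_base (hφ : φ ∈ IsManifold.maximalAtlas (𝓡 m) ∞ M)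
    (hS : ∀ p ∈ S, (h p).base ∈ φ.source) (hc : ContinuousOn (fun p => coord φ (h p)) S) :
    ContinuousOn (fun p => φ (h p).base) S := by
  have h1 : ContinuousOn (fun p => WithLp.toLp 2 fun i => re (coord φ (h p) i)) S :=
    (PiLp.continuous_toLp 2 _).comp_continuousOn (continuousOn_pi.2 fun i =>
      continuous_re.comp_continuousOn (continuousOn_pi.1 hc i))
  refine h1.congr fun p hp => ?_
  ext i
  exact (re_coord hφ (hS p hp) i).symm

theorem continuousOn_base (hφ : φ ∈ IsManifold.maximalAtlas (𝓡 m) ∞ M)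
    (hS : ∀ p ∈ S, (h p).base ∈ φ.source) (hc : ContinuousOn (fun p => coord φ (h p)) S) :
    ContinuousOn (fun p => (h p).base) S := by
  have := φ.continuousOn_symm.comp (continuousOn_chart_base hφ hS hc)
    (fun p hp => φ.map_source (hS p hp))
  exact this.congr fun p hp => (φ.left_inv (hS p hp)).symm

/-- An infinitely near point depends continuously on its coordinates: the case of a function
multiplied by an infinitesimal of high order. -/
theorem continuousOn_mul_eval (hφ : φ ∈ IsManifold.maximalAtlas (𝓡 m) ∞ M)
    (hS : ∀ p ∈ S, (h p).base ∈ φ.source) (hc : ContinuousOn (fun p => coord φ (h p)) S)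
    {k : ℕ} (hk : (infIdeal : Ideal A) ^ k = ⊥) (d j : ℕ) (hd : j + d = k) :
    ∀ c : X → A, ContinuousOn c S → (∀ p ∈ S, c p ∈ (infIdeal : Ideal A) ^ j) →
    ∀ G : EuclideanSpace ℝ (Fin m) × EuclideanSpace ℝ (Fin m) → ℝ, ContDiff ℝ ∞ G →
      ContinuousOn (fun p => c p * (h p).eval fun y => G (φ (h p).base, φ y)) S := by
  have := continuousMul A
  induction d generalizing j with
  | zero =>
    intro c _ hcj G _
    obtain rfl : j = k := by simpa using hd
    refine continuousOn_const (c := (0 : A)) |>.congr fun p hp => ?_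
    have h0 := hcj p hp
    rw [hk, Ideal.mem_bot] at h0
    simp only [h0, zero_mul]
  | succ d ih =>
    intro c hcc hcj G hG
    -- Expanding at the base point, each remainder term gains a factor in `𝒜`, so `j` rises by one.
    -- The quotients `D i` depend on the base point too, hence `G` has two arguments.
    obtain ⟨D, hD, hGD⟩ := exists_contDiff_eq_add_sum_sub_mul hG
    have hr := continuousOn_chart_base hφ hS hc
    have hri : ∀ i, ContinuousOn (fun p => algebraMap ℝ A (φ (h p).base i)) S := fun i => by
      simp_rw [Algebra.algebraMap_eq_smul_one]
      exact ContinuousOn.smul ((EuclideanSpace.proj (𝕜 := ℝ) i).continuous.comp_continuousOn hr)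
        continuousOn_const
    have hi : ∀ i, ContinuousOn (fun p => c p * (coord φ (h p) i -
        algebraMap ℝ A (φ (h p).base i)) * (h p).eval fun y => D i (φ (h p).base, φ y)) S := by
      refine fun i => ih (j + 1) (by omega) _ (hcc.mul ((continuousOn_pi.1 hc i).sub (hri i)))
        (fun p hp => ?_) (D i) (hD i)
      rw [pow_succ]
      refine Ideal.mul_mem_mul (hcj p hp) ?_
      change coord φ (h p) i - algebraMap ℝ A (φ (h p).base i) ∈ _
      rw [← re_coord hφ (hS p hp) i]
      exact sub_algebraMap_re_mem _
    have h0 : ContinuousOn (fun p => c p * algebraMap ℝ A (G (φ (h p).base, φ (h p).base))) S := by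
      simp_rw [Algebra.algebraMap_eq_smul_one]
      exact hcc.mul (ContinuousOn.smul (hG.continuous.comp_continuousOn (hr.prodMk hr))
        continuousOn_const)
    refine (h0.add (continuousOn_finsetSum Finset.univ fun i _ => hi i)).congr fun p hp => ?_
    have hx := hS p hp
    set x := (h p).base with hxdef
    have g1 : ∀ i, SmoothGerm m x (fun y => D i (φ x, φ y)) := fun i =>
      smoothGerm_comp_chart hφ hx (g := fun v => D i (φ x, v))
        ((hD i).comp (contDiff_const.prodMk contDiff_id))
    have g2 : ∀ i, SmoothGerm m x (fun y => φ y i + -φ x i) := fun i =>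
      (smoothGerm_chart hφ hx i).add (.const x _)
    have g3 : ∀ i, SmoothGerm m x (fun y => (φ y i + -φ x i) * D i (φ x, φ y)) := fun i =>
      (g2 i).mul (g1 i)
    have e1 : (fun y => G (φ x, φ y)) =
        fun y => G (φ x, φ x) + ∑ i, (φ y i + -φ x i) * D i (φ x, φ y) := by
      funext y
      rw [hGD (φ x) (φ y)]
      simp_rw [sub_eq_add_neg]
    have e2 : ∀ i, (h p).eval (fun y => (φ y i + -φ x i) * D i (φ x, φ y)) =
        (coord φ (h p) i - algebraMap ℝ A (φ x i)) * (h p).eval fun y => D i (φ x, φ y) :=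
      fun i => by
        rw [(h p).eval_mul (g2 i) (g1 i),
          (h p).eval_add (h := fun y => φ y i) (smoothGerm_chart hφ hx i) (.const x _),
          eval_const, map_neg, ← sub_eq_add_neg, coord]
    change c p * (h p).eval (fun y => G (φ x, φ y)) = c p * algebraMap ℝ A (G (φ x, φ x)) + _
    rw [e1, (h p).eval_add (.const x _) (SmoothGerm.sum _ fun i _ => g3 i), eval_const,
      (h p).eval_sum _ fun i _ => g3 i, mul_add, Finset.mul_sum]
    simp_rw [e2, mul_assoc]
    rfl

theorem continuousOn_hom_of_coord (hφ : φ ∈ IsManifold.maximalAtlas (𝓡 m) ∞ M)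
    (hS : ∀ p ∈ S, (h p).base ∈ φ.source) (hc : ContinuousOn (fun p => coord φ (h p)) S)
    (f : C^∞⟮𝓡 m, M; 𝓘(ℝ, ℝ), ℝ⟯) : ContinuousOn (fun p => (h p).hom f) S := by
  intro p₀ hp₀
  have hx := hS p₀ hp₀
  obtain ⟨g, hg⟩ : SmoothGerm m (φ (h p₀).base) (fun v => f (φ.symm v)) :=
    .of_contMDiffOn φ.open_target (φ.map_source hx)
      (f.contMDiff.comp_contMDiffOn (contMDiffOn_symm_of_mem_maximalAtlas hφ))
  have hfg : ∀ᶠ y in 𝓝 (h p₀).base, f y = g (φ y) := by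
    filter_upwards [(φ.continuousAt hx).eventually hg, φ.open_source.mem_nhds hx] with y hy hys
    rw [hy, φ.left_inv hys]
  -- One `g` represents `f` at all base points near that of `h p₀`, so it serves for all `p` in `S`
  -- near `p₀`.
  have hev := (continuousOn_base hφ hS hc p₀ hp₀).eventually hfg.eventually_nhds
  obtain ⟨k, -, hk⟩ := (nilpotent : ∃ k : ℕ, 1 ≤ k ∧ (infIdeal : Ideal A) ^ (k + 1) = ⊥)
  -- Start with the factor 1 in `𝒜 ^ 0 = ⊤`.
  have hcont := continuousOn_mul_eval hφ hS hc hk (k + 1) 0 (zero_add _) (fun _ => 1)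
    continuousOn_const (by simp) (fun q => g q.2) (g.contMDiff.contDiff.comp contDiff_snd) p₀ hp₀
  refine hcont.congr_of_eventuallyEq ?_ ?_
  · filter_upwards [hev] with p hp
    rw [one_mul, eval_comp_chart (g := g) hp]
  · rw [one_mul, eval_comp_chart (g := g) hfg]

theorem continuous_hom (f : C^∞⟮𝓡 m, M; 𝓘(ℝ, ℝ), ℝ⟯) :
    Continuous (fun ξ : WeilBundle m M A => ξ.hom f) := by
  refine continuous_iff_continuousAt.2 fun ξ => ?_
  have hφ := IsManifold.chart_mem_maximalAtlas (I := 𝓡 m) (n := ∞) ξ.base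
  exact (continuousOn_hom_of_coord (h := id) hφ (fun _ hp => hp) (continuousOn_coord hφ) f
    ).continuousAt ((isOpen_setOf_base_mem_source hφ).mem_nhds (mem_chart_source _ ξ.base))

/-- The topology of the Weil bundle is that of pointwise convergence on `C^∞(M)`. -/
theorem isInducing_hom :
    Topology.IsInducing (fun (ξ : WeilBundle m M A) (f : C^∞⟮𝓡 m, M; 𝓘(ℝ, ℝ), ℝ⟯) => ξ.hom f) := by
  refine ⟨le_antisymm (continuous_iff_le_induced.1 (continuous_pi continuous_hom))
    (le_generateFrom ?_)⟩
  rintro _ ⟨φ, hφ, W, hW, rfl⟩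
  refine (@isOpen_iff_mem_nhds _ (.induced _ _) _).2 ?_
  rintro ξ ⟨a, haW, hξ, ha⟩
  rw [mem_nhds_induced]
  choose f hf hfa using ha
  obtain rfl : (fun i => ξ.hom (f i)) = a := funext hfa
  have hN : ∀ᶠ y in 𝓝 ξ.base, y ∈ φ.source ∧ ∀ i, (f i : M → ℝ) =ᶠ[𝓝 y] fun y => φ y i :=
    (φ.open_source.eventually_mem hξ).and
      (Filter.eventually_all.2 fun i => (hf i).eventuallyEq_nhds)
  obtain ⟨χ, hχ1, hχN⟩ := exists_contMDiffMap_eventuallyEq_one_tsupport_subset (m := m) hN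
  -- Since `re (η.hom χ) = χ η.base`, the first condition confines the base point to where every `f
  -- i` has the germ of the chart coordinate; the values `η.hom (f i)` are then the chart values.
  refine ⟨{v | re (v χ) ≠ 0} ∩ (fun v i => v (f i)) ⁻¹' W, ?_, ?_⟩
  · refine IsOpen.mem_nhds (IsOpen.inter ?_ (hW.preimage (by fun_prop))) ⟨?_, haW⟩
    · exact (continuous_re.comp (continuous_apply χ)).isOpen_preimage _ isOpen_ne
    · change re (ξ.hom χ) ≠ 0
      rw [re_hom, hχ1.eq_of_nhds]
      exact one_ne_zero
  · rintro η ⟨h1, h2⟩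
    change re (η.hom χ) ≠ 0 at h1
    rw [re_hom] at h1
    obtain ⟨h3, h4⟩ := hχN (subset_tsupport _ h1)
    exact ⟨_, h2, h3, fun i => ⟨f i, h4 i, rfl⟩⟩

theorem continuousOn_of_coord (hφ : φ ∈ IsManifold.maximalAtlas (𝓡 m) ∞ M)
    (hS : ∀ p ∈ S, (h p).base ∈ φ.source) (hc : ContinuousOn (fun p => coord φ (h p)) S) :
    ContinuousOn h S :=
  isInducing_hom.continuousOn_iff.2 (continuousOn_pi.2 (continuousOn_hom_of_coord hφ hS hc))

variable (M A) in
theorem continuous_base : Continuous (base : WeilBundle m M A → M) := by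
  refine continuous_iff_continuousAt.2 fun ξ => ?_
  have hφ := IsManifold.chart_mem_maximalAtlas (I := 𝓡 m) (n := ∞) ξ.base
  exact (continuousOn_base (h := id) hφ (fun _ hp => hp) (continuousOn_coord hφ)
    ).continuousAt ((isOpen_setOf_base_mem_source hφ).mem_nhds (mem_chart_source _ ξ.base))

variable (M A) in
theorem continuous_zeroSection : Continuous (zeroSection A : M → WeilBundle m M A) := by
  refine isInducing_hom.continuous_iff.2 (continuous_pi fun f => ?_)
  change Continuous fun x => algebraMap ℝ A (f x)
  simp_rw [Algebra.algebraMap_eq_smul_one]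
  exact f.contMDiff.continuous.smul continuous_const

end WeilBundle

/-! ### Contraction onto the zero section by homotheties. -/

namespace WeilBundle

open WeilAlgebra

variable {m : ℕ} {M : Type*} [TopologicalSpace M]
  {φ : OpenPartialHomeomorph M (EuclideanSpace ℝ (Fin m))}

/-- The homothety with centre `x` and ratio `s` in the chart `φ`. -/
noncomputable def homothety (φ : OpenPartialHomeomorph M (EuclideanSpace ℝ (Fin m))) (x : M)
    (s : ℝ) (y : M) : M := φ.symm (φ x + s • (φ y - φ x))

/-- A domain on which the homothety with centre `x` and ratio `s` in the chart `φ` is defined. -/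
def homothetyDomain (φ : OpenPartialHomeomorph M (EuclideanSpace ℝ (Fin m))) (x : M)
    (s : ℝ) : Set M := φ.source ∩ φ ⁻¹' {v | φ x + s • (v - φ x) ∈ φ.target}

theorem homothety_self {x : M} (hx : x ∈ φ.source) (s : ℝ) : homothety φ x s x = x := by
  rw [homothety, sub_self, smul_zero, add_zero, φ.left_inv hx]

theorem isOpen_homothetyDomain (x : M) (s : ℝ) : IsOpen (homothetyDomain φ x s) :=
  φ.isOpen_inter_preimage (φ.open_target.preimage (by fun_prop))

/-- The centre is fixed, so the homothety has a germ there for every ratio, with no convexity of the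
chart's target. -/
theorem self_mem_homothetyDomain {x : M} (hx : x ∈ φ.source) (s : ℝ) :
    x ∈ homothetyDomain φ x s := by
  refine ⟨hx, ?_⟩
  change φ x + s • (φ x - φ x) ∈ φ.target
  rw [sub_self, smul_zero, add_zero]
  exact φ.map_source hx

theorem chart_homothety {x y : M} {s : ℝ} (hy : y ∈ homothetyDomain φ x s) :
    φ (homothety φ x s y) = φ x + s • (φ y - φ x) := φ.right_inv hy.2

variable [ChartedSpace (EuclideanSpace ℝ (Fin m)) M]
  {A : Type*} [CommRing A] [Algebra ℝ A] [WeilAlgebra A]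

theorem contMDiffOn_homothety (hφ : φ ∈ IsManifold.maximalAtlas (𝓡 m) ∞ M) (x : M) (s : ℝ) :
    ContMDiffOn (𝓡 m) (𝓡 m) ∞ (homothety φ x s) (homothetyDomain φ x s) := by
  have h1 : ContDiff ℝ ∞ fun v : EuclideanSpace ℝ (Fin m) => φ x + s • (v - φ x) := by fun_prop
  exact (contMDiffOn_symm_of_mem_maximalAtlas hφ).comp (h1.contMDiff.comp_contMDiffOn
    ((contMDiffOn_of_mem_maximalAtlas hφ).mono Set.inter_subset_left)) fun y hy => hy.2

section IsContractionOver

variable [TopologicalSpace A]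

/-- A homotopy of the identity of the Weil bundle, over the base and fixing the zero section, which
ends in the zero section over the set `s`. -/
structure IsContractionOver (s : Set M)
    (K : unitInterval × WeilBundle m M A → WeilBundle m M A) : Prop where
  continuous : Continuous K
  apply_zero : ∀ ξ, K (0, ξ) = ξ
  apply_base : ∀ t ξ, (K (t, ξ)).base = ξ.base
  apply_zeroSection : ∀ t x, K (t, zeroSection A x) = zeroSection A x
  apply_one : ∀ ξ, ξ.base ∈ s → K (1, ξ) = zeroSection A ξ.base

/-- Both homotopies run at the same time `t`. At time 1, `K'` either fixes a point `K` has sent to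
the zero section, or contracts a point still over `s'`. -/
theorem IsContractionOver.union {s s' : Set M}
    {K K' : unitInterval × WeilBundle m M A → WeilBundle m M A} (hK : IsContractionOver s K)
    (hK' : IsContractionOver s' K') :
    IsContractionOver (s ∪ s') fun p => K' (p.1, K p) where
  continuous := hK'.continuous.comp (continuous_fst.prodMk hK.continuous)
  apply_zero ξ := by simp_rw [hK.apply_zero, hK'.apply_zero]
  apply_base t ξ := by simp_rw [hK'.apply_base, hK.apply_base]
  apply_zeroSection t x := by simp_rw [hK.apply_zeroSection, hK'.apply_zeroSection]
  apply_one ξ hξ := by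
    rcases hξ with hξ | hξ
    · simp_rw [hK.apply_one ξ hξ, hK'.apply_zeroSection]
    · have hb := hK.apply_base 1 ξ
      exact (hK'.apply_one _ (hb ▸ hξ)).trans (congrArg _ hb)

end IsContractionOver

variable [T2Space M] [IsManifold (𝓡 m) ∞ M]

theorem smoothGerm_comp_homothety
    (hφ : φ ∈ IsManifold.maximalAtlas (𝓡 m) ∞ M) (s : ℝ) {x : M} (hx : x ∈ φ.source)
    (f : C^∞⟮𝓡 m, M; 𝓘(ℝ, ℝ), ℝ⟯) : SmoothGerm m x (fun y => f (homothety φ x s y)) :=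
  .of_contMDiffOn (isOpen_homothetyDomain _ _) (self_mem_homothetyDomain hx s)
    (f.contMDiff.comp_contMDiffOn (contMDiffOn_homothety hφ x s))

/-- The image of an infinitely near point under a homothety centred at its base point. -/
noncomputable def contract (hφ : φ ∈ IsManifold.maximalAtlas (𝓡 m) ∞ M) (s : ℝ)
    (ξ : WeilBundle m M A) (hξ : ξ.base ∈ φ.source) : WeilBundle m M A :=
  ξ.map (homothety φ ξ.base s) (homothetyDomain φ ξ.base s) (isOpen_homothetyDomain _ _)
    (self_mem_homothetyDomain hξ s) (contMDiffOn_homothety hφ _ _)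

section contract

variable (hφ : φ ∈ IsManifold.maximalAtlas (𝓡 m) ∞ M) (s : ℝ)
  (ξ : WeilBundle m M A) (hξ : ξ.base ∈ φ.source)

theorem contract_base : (contract hφ s ξ hξ).base = ξ.base := homothety_self hξ s

theorem contract_one : contract hφ 1 ξ hξ = ξ := by
  refine ext (contract_base hφ 1 ξ hξ) fun f => ?_
  refine (ξ.eval_congr (smoothGerm_comp_homothety hφ 1 hξ f) ?_).trans (ξ.eval_coe f)
  filter_upwards [φ.open_source.mem_nhds hξ] with y hy
  rw [homothety, one_smul, add_sub_cancel, φ.left_inv hy]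

theorem contract_zero : contract hφ 0 ξ hξ = zeroSection A ξ.base := by
  refine ext (contract_base hφ 0 ξ hξ) fun f => ?_
  refine Eq.trans ?_ (ξ.eval_const (f ξ.base))
  refine congrArg ξ.eval (funext fun y => ?_)
  rw [homothety, zero_smul, add_zero, φ.left_inv hξ]

theorem contract_zeroSection (x : M) (hx : x ∈ φ.source) :
    contract hφ s (zeroSection A x) hx = zeroSection A x := by
  refine ext (contract_base hφ s _ hx) fun f => ?_
  obtain ⟨g, hg⟩ := smoothGerm_comp_homothety hφ s hx f
  refine ((zeroSection A x).eval_eq_hom hg).trans ?_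
  rw [zeroSection_hom, zeroSection_hom, hg.eq_of_nhds, homothety_self hx]

/-- The homothety is affine in the chart. The formula makes joint continuity in `s` and `ξ` visible.
-/
theorem coord_contract (i : Fin m) : coord φ (contract hφ s ξ hξ) i =
    algebraMap ℝ A (φ ξ.base i) + s • (coord φ ξ i - algebraMap ℝ A (φ ξ.base i)) := by
  have g1 := smoothGerm_chart hφ hξ i
  have e1 : (fun y => φ (homothety φ ξ.base s y) i) =ᶠ[𝓝 ξ.base]
      fun y => φ ξ.base i + s * (φ y i + -φ ξ.base i) := by
    filter_upwards [(isOpen_homothetyDomain ξ.base s).mem_nhds (self_mem_homothetyDomain hξ s)]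
      with y hy
    rw [chart_homothety hy]
    simp only [PiLp.add_apply, PiLp.smul_apply, PiLp.sub_apply, smul_eq_mul, ← sub_eq_add_neg]
  have g2 : SmoothGerm m ξ.base (fun y => φ y i + -φ ξ.base i) := g1.add (.const _ _)
  have g3 : SmoothGerm m ξ.base (fun y => s * (φ y i + -φ ξ.base i)) :=
    SmoothGerm.mul (.const _ s) g2
  have g4 : SmoothGerm m ξ.base (fun y => φ ξ.base i + s * (φ y i + -φ ξ.base i)) :=
    SmoothGerm.add (.const _ _) g3
  have hb : homothety φ ξ.base s ξ.base ∈ φ.source := by rwa [homothety_self hξ]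
  rw [coord, contract, map_eval _ _ _ _ _ _ (smoothGerm_chart hφ hb i),
    ξ.eval_congr (g4.congr e1.symm) e1, ξ.eval_add (.const _ _) g3, eval_const,
    ξ.eval_mul (.const _ s) g2, eval_const, ξ.eval_add (h := fun y => φ y i) g1 (.const _ _),
    eval_const, map_neg, ← sub_eq_add_neg, ← Algebra.smul_def, coord]

end contract

open Classical in
/-- A homotopy moving the infinitely near points towards the zero section over the set where the
function `ρ`, supported in the domain of the chart `φ`, does not vanish. -/
noncomputable def localContraction (hφ : φ ∈ IsManifold.maximalAtlas (𝓡 m) ∞ M) (ρ : M → ℝ)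
    (p : unitInterval × WeilBundle m M A) : WeilBundle m M A :=
  if h : p.2.base ∈ φ.source then contract hφ (1 - p.1 * ρ p.2.base) p.2 h else p.2

section localContraction

variable (hφ : φ ∈ IsManifold.maximalAtlas (𝓡 m) ∞ M) (ρ : M → ℝ)

theorem localContraction_base (p : unitInterval × WeilBundle m M A) :
    (localContraction hφ ρ p).base = p.2.base := by
  unfold localContraction
  split_ifs with h
  · exact contract_base ..
  · rfl

theorem localContraction_of_mul_eq_zero {p : unitInterval × WeilBundle m M A}
    (hp : (p.1 : ℝ) * ρ p.2.base = 0) : localContraction hφ ρ p = p.2 := by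
  unfold localContraction
  split_ifs with h
  · simp_rw [hp, sub_zero]
    exact contract_one hφ _ h
  · rfl

theorem localContraction_zeroSection (t : unitInterval) (x : M) :
    localContraction hφ ρ (t, zeroSection A x) = zeroSection A x := by
  unfold localContraction
  split_ifs with h
  · exact contract_zeroSection hφ _ x h
  · rfl

theorem localContraction_one {ξ : WeilBundle m M A} (hξ : ξ.base ∈ φ.source)
    (h1 : ρ ξ.base = 1) : localContraction hφ ρ (1, ξ) = zeroSection A ξ.base := by
  rw [localContraction, dif_pos hξ]
  simp_rw [h1, Set.Icc.coe_one, mul_one, sub_self]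
  exact contract_zero hφ ξ hξ

variable [TopologicalSpace A] [IsTopologicalAddGroup A] [ContinuousSMul ℝ A] [T2Space A]

/-- Two open sets cover: over `φ.source` the coordinate formula is continuous, and off `tsupport ρ`
the ratio is 1, so nothing moves. -/
theorem continuous_localContraction (hρ : Continuous ρ) (hρs : tsupport ρ ⊆ φ.source) :
    Continuous (localContraction hφ ρ : unitInterval × WeilBundle m M A → WeilBundle m M A) := by
  have hb : Continuous fun p : unitInterval × WeilBundle m M A => p.2.base :=
    (continuous_base M A).comp continuous_snd
  refine continuous_iff_continuousAt.2 fun p => ?_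
  by_cases hp : p.2.base ∈ φ.source
  · set S : Set (unitInterval × WeilBundle m M A) := {p | p.2.base ∈ φ.source}
    have hS : IsOpen S := φ.open_source.preimage hb
    have hc : ContinuousOn (fun p : unitInterval × WeilBundle m M A => coord φ p.2) S :=
      (continuousOn_coord hφ).comp continuousOn_snd fun p hp => hp
    have hr := continuousOn_chart_base (h := Prod.snd) hφ (fun p (hp : p ∈ S) => hp) hc
    refine (continuousOn_of_coord hφ (fun p (hp : p ∈ S) => ?_) (continuousOn_pi.2 fun i => ?_)
      ).continuousAt (hS.mem_nhds hp)
    · rw [localContraction_base]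
      exact hp
    · have hri : ContinuousOn (fun p : unitInterval × WeilBundle m M A =>
          algebraMap ℝ A (φ p.2.base i)) S := by
        simp_rw [Algebra.algebraMap_eq_smul_one]
        exact ContinuousOn.smul ((EuclideanSpace.proj (𝕜 := ℝ) i).continuous.comp_continuousOn hr)
          continuousOn_const
      have hs : Continuous fun p : unitInterval × WeilBundle m M A =>
          1 - (p.1 : ℝ) * ρ p.2.base := by fun_prop
      refine (hri.add (hs.continuousOn.smul ((continuousOn_pi.1 hc i).sub hri))).congr
        fun p hp => ?_
      rw [localContraction, dif_pos (show p.2.base ∈ φ.source from hp), coord_contract]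
      rfl
  · have hopen : IsOpen {p : unitInterval × WeilBundle m M A | p.2.base ∉ tsupport ρ} :=
      (isClosed_tsupport ρ).isOpen_compl.preimage hb
    refine continuousAt_snd.congr ?_
    filter_upwards [hopen.mem_nhds fun h => hp (hρs h)] with q hq
    rw [localContraction_of_mul_eq_zero]
    rw [image_eq_zero_of_notMem_tsupport hq, mul_zero]

end localContraction

variable [TopologicalSpace A] [IsTopologicalAddGroup A] [ContinuousSMul ℝ A] [T2Space A]

variable (m M A) in
/-- The Weil bundle of a compact manifold deformation retracts onto its zero section. -/
theorem exists_isContractionOver_univ [CompactSpace M] :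
    ∃ K : unitInterval × WeilBundle m M A → WeilBundle m M A, IsContractionOver Set.univ K := by
  refine isCompact_univ.induction_on (p := fun s : Set M =>
    ∃ K : unitInterval × WeilBundle m M A → WeilBundle m M A, IsContractionOver s K) ?_ ?_ ?_ ?_
  · exact ⟨Prod.snd, continuous_snd, fun _ => rfl, fun _ _ => rfl, fun _ _ => rfl,
      fun _ h => h.elim⟩
  · rintro s t hst ⟨K, hK⟩
    exact ⟨K, { hK with apply_one := fun ξ hξ => hK.apply_one ξ (hst hξ) }⟩
  · rintro s t ⟨K, hK⟩ ⟨K', hK'⟩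
    exact ⟨_, hK.union hK'⟩
  · intro x _
    have hx := chart_source_mem_nhds (EuclideanSpace ℝ (Fin m)) x
    obtain ⟨ρ, hρ1, hρs⟩ := exists_contMDiffMap_eventuallyEq_one_tsupport_subset (m := m) hx
    have hφ := IsManifold.chart_mem_maximalAtlas (I := 𝓡 m) (n := ∞) x
    -- Where `ρ = 1` the ratio `1 - t * ρ` reaches 0 at `t = 1`.
    refine ⟨{y | y ∈ (chartAt (EuclideanSpace ℝ (Fin m)) x).source ∧ ρ y = 1},
      mem_nhdsWithin_of_mem_nhds (Filter.inter_mem hx hρ1),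
      localContraction hφ ρ, continuous_localContraction hφ ρ ρ.contMDiff.continuous hρs,
      fun ξ => localContraction_of_mul_eq_zero hφ ρ (by simp),
      fun t ξ => localContraction_base hφ ρ (t, ξ),
      localContraction_zeroSection hφ ρ, fun ξ hξ => localContraction_one hφ ρ hξ.1 hξ.2⟩

variable (m M A) in
/-- The projection of the Weil bundle of a compact manifold is a homotopy equivalence. -/
theorem nonempty_homotopyEquiv [CompactSpace M] :
    Nonempty (ContinuousMap.HomotopyEquiv (WeilBundle m M A) M) := by
  obtain ⟨K, hK⟩ := exists_isContractionOver_univ m M A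
  exact ⟨{
    toFun := ⟨base, continuous_base M A⟩
    invFun := ⟨zeroSection A, continuous_zeroSection M A⟩
    left_inv := ⟨ContinuousMap.Homotopy.symm
      { toFun := K
        continuous_toFun := hK.continuous
        map_zero_left := hK.apply_zero
        map_one_left := fun ξ => hK.apply_one ξ trivial }⟩
    right_inv := ContinuousMap.Homotopic.refl _ }⟩

theorem joined_zeroSection [CompactSpace M] (ξ : WeilBundle m M A) :
    Joined ξ (zeroSection A ξ.base) := by
  obtain ⟨K, hK⟩ := exists_isContractionOver_univ m M A
  exact ⟨{
    toFun := fun t => K (t, ξ)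
    continuous_toFun := hK.continuous.comp (Continuous.prodMk_left ξ)
    source' := hK.apply_zero ξ
    target' := hK.apply_one ξ trivial }⟩

end WeilBundle

/-! ### Transfer of connectedness properties. -/

/-- The topology of `A` is its unique Hausdorff vector space topology. -/
theorem lemma3p3 (m : ℕ) (M : Type*) [TopologicalSpace M] [T2Space M] [CompactSpace M]
    [ChartedSpace (EuclideanSpace ℝ (Fin m)) M] [IsManifold (𝓡 m) ∞ M]
    (A : Type*) [CommRing A] [Algebra ℝ A] [WeilAlgebra A]
    [TopologicalSpace A] [IsTopologicalAddGroup A] [ContinuousSMul ℝ A] [T2Space A] :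
    (ConnectedSpace M → ConnectedSpace (WeilBundle m M A)) ∧
    (PathConnectedSpace M → PathConnectedSpace (WeilBundle m M A)) ∧
    (SimplyConnectedSpace M → SimplyConnectedSpace (WeilBundle m M A)) := by
  have hj := WeilBundle.joined_zeroSection (m := m) (M := M) (A := A)
  have hz := WeilBundle.continuous_zeroSection (m := m) M A
  refine ⟨fun _ => ?_, fun _ => ?_, fun _ => ?_⟩
  · refine connectedSpace_iff_connectedComponent.2
      ⟨WeilBundle.zeroSection A (Classical.arbitrary M), Set.eq_univ_of_forall fun ξ => ?_⟩
    -- The zero section is a connected image of `M`, and every `ξ` is joined to it by a path.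
    have h1 := (isConnected_range hz).isPreconnected.subset_connectedComponent
      (Set.mem_range_self (Classical.arbitrary M)) (Set.mem_range_self ξ.base)
    rw [connectedComponent_eq h1]
    exact pathComponent_subset_component _ (hj ξ).symm
  · exact ⟨⟨WeilBundle.zeroSection A (Classical.arbitrary M)⟩, fun ξ η => (hj ξ).trans
      (((PathConnectedSpace.joined ξ.base η.base).map hz).trans (hj η).symm)⟩
  · exact (WeilBundle.nonempty_homotopyEquiv m M A).some.simplyConnectedSpace
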